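/- Write $\mathbb{T}=\{z\in\mathbb{C} : |z|=1\}$ and let $dz$ denote the $N$-fold product of the normalized Lebesgue measure on $\mathbb{T}^N$. For $2\le q<\infty$, a complex Banach space $X$ has cotype $q$ if there is a constant $C\ge 0$ such that for every choice of finitely many vectors $x_1,\dots,x_N\in X$ $$\Big(\sum_{k=1}^N \|x_k\|_X^q\Big)^{1/q}\le C\Big(\int_{\mathbb{T}^N}\Big\|\sum_{k=1}^N x_k z_k\Big\|_X^2\,dz\Big)^{1/2};$$ the best such constant is denoted by $C_q(X)$. Let $K\ge 1$ be the Kahane constant, i.e. the best constant such that for every complex Banach space $Y$ and every choice of finitely many vectors $x_1,\dots,x_N\in Y$ $$\Big(\int_{\mathbb{T}^N}\Big\|\sum_{k=1}^N x_k z_k\Big\|_Y^2\,dz\Big)^{1/2}\le K\int_{\mathbb{T}^N}\Big\|\sum_{k=1}^N x_k z_k\Big\|_Y\,dz.$$ **Proposition.** Let $X$ be a complex Banach space of cotype $q$, $2\le q<\infty$, let $N,m$ be non-negative integers (with $0^0=1$), and let $$P:\mathbb{C}^N\to X,\qquad P(z)=\sum_{\alpha\in\mathbb{N}_0^N,\ |\alpha|=m}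 c_\alpha z^\alpha,\qquad c_\alpha\in X,$$ be an $m$-homogeneous polynomial. Let $T:\mathbb{C}^N\times\dots\times\mathbb{C}^N\to X$, $$T(z^{(1)},\dots,z^{(m)})=\sum_{i_1,\dots,i_m=1}^N a_{i_1,\dots,i_m}\, z^{(1)}_{i_1}\cdots z^{(m)}_{i_m},$$ be the $m$-linear symmetrization of $P$, that is, the unique symmetric $m$-linear map with $T(z,\dots,z)=P(z)$ for all $z\in\mathbb{C}^N$. Then $$\Big(\sum_{i_1,\dots,i_m=1}^N\big\|a_{i_1,\dots,i_m}\big\|_X^q\Big)^{1/q}\le\big(C_q(X)\,K\big)^m\,\frac{m^m}{m!}\int_{\mathbb{T}^N}\|P(z)\|_X\,dz.$$ -/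

import Mathlib

open MeasureTheory

universe u

noncomputable section

/-- The circle `𝕋 = {z ∈ ℂ : |z| = 1}` carries its Borel σ-algebra. -/
instance Circle.instMeasurableSpaceBorel : MeasurableSpace Circle := borel Circle

instance Circle.instBorelSpace : BorelSpace Circle := ⟨rfl⟩

/-- Normalized Lebesgue (arc length) measure on the circle: the image under `t ↦ exp (i t)` of
`dt / 2π` on `(0, 2π]`. -/
def circleLebesgue : Measure Circle :=
  Measure.map (fun t : ℝ => Circle.exp t)
    ((ENNReal.ofReal (2 * Real.pi))⁻¹ • volume.restrict (Set.Ioc 0 (2 * Real.pi)))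

instance circleLebesgue.instIsProbabilityMeasure : IsProbabilityMeasure circleLebesgue := by
  have hpos : 0 < 2 * Real.pi := by positivity
  constructor
  have hm : Measurable (fun t : ℝ => Circle.exp t) := Circle.exp.continuous.measurable
  rw [circleLebesgue, Measure.map_apply hm MeasurableSet.univ]
  simp only [Set.preimage_univ, Measure.smul_apply, Measure.restrict_apply_univ,
    Real.volume_Ioc, sub_zero, smul_eq_mul]
  exact ENNReal.inv_mul_cancel (by simpa using hpos) ENNReal.ofReal_ne_top

/-- The `N`-fold product of the normalized Lebesgue measure, on the torus `𝕋^N`. -/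
def torusLebesgue (N : ℕ) : Measure (Fin N → Circle) :=
  Measure.pi fun _ => circleLebesgue

instance torusLebesgue.instIsProbabilityMeasure (N : ℕ) :
    IsProbabilityMeasure (torusLebesgue N) := by
  unfold torusLebesgue
  infer_instance

/-- `C ≥ 0` is an admissible constant in the cotype `q` inequality
`(∑ ‖x_k‖^q)^(1/q) ≤ C (∫_{𝕋^N} ‖∑ z_k x_k‖² dz)^(1/2)`, for all finite families in `X`. -/
def IsCotypeConstant (X : Type*) [NormedAddCommGroup X] [NormedSpace ℂ X] (q C : ℝ) : Prop :=
  0 ≤ C ∧ ∀ (N : ℕ) (x : Fin N → X),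
    (∑ k, ‖x k‖ ^ q) ^ (1 / q) ≤
      C * (∫ z, ‖∑ k, (z k : ℂ) • x k‖ ^ 2 ∂torusLebesgue N) ^ (1 / 2 : ℝ)

/-- `X` has cotype `q` (for exponents `2 ≤ q < ∞`). -/
def HasCotype (X : Type*) [NormedAddCommGroup X] [NormedSpace ℂ X] (q : ℝ) : Prop :=
  ∃ C : ℝ, IsCotypeConstant X q C

/-- The cotype `q` constant `C_q(X)`: the best admissible constant. -/
def cotypeConst (X : Type*) [NormedAddCommGroup X] [NormedSpace ℂ X] (q : ℝ) : ℝ :=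
  sInf {C : ℝ | IsCotypeConstant X q C}

/-- `K ≥ 1` is an admissible constant in the inequality
`(∫_{𝕋^N} ‖∑ z_k x_k‖² dz)^(1/2) ≤ K ∫_{𝕋^N} ‖∑ z_k x_k‖ dz`,
for all complex Banach spaces and all finite families of vectors. -/
def IsKahaneConstant (K : ℝ) : Prop :=
  1 ≤ K ∧ ∀ (Y : Type u) [NormedAddCommGroup Y] [NormedSpace ℂ Y] [CompleteSpace Y]
    (N : ℕ) (x : Fin N → Y),
    (∫ z, ‖∑ k, (z k : ℂ) • x k‖ ^ 2 ∂torusLebesgue N) ^ (1 / 2 : ℝ) ≤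
      K * ∫ z, ‖∑ k, (z k : ℂ) • x k‖ ∂torusLebesgue N

/-- The Kahane constant `K`: the best admissible constant. -/
def kahaneConst : ℝ :=
  sInf {K : ℝ | IsKahaneConstant.{u} K}

/-- `P : ℂ^N → X` is the `m`-homogeneous polynomial `P(z) = ∑_{|α| = m} z^α c_α`. -/
def IsHomogeneousPoly {X : Type*} [NormedAddCommGroup X] [NormedSpace ℂ X] (N m : ℕ)
    (c : (Fin N → ℕ) → X) (P : (Fin N → ℂ) → X) : Prop :=
  ∀ z : Fin N → ℂ,
    P z = ∑ α ∈ Finset.piAntidiag (Finset.univ : Finset (Fin N)) m, (∏ k, z k ^ α k) • c α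

/-- `T` is the `m`-linear symmetrization of `P : ℂ^N → X`: it is a symmetric `m`-linear map whose
restriction to the diagonal is `P`. -/
def IsSymmetrization {X : Type*} [NormedAddCommGroup X] [NormedSpace ℂ X] {N m : ℕ}
    (T : MultilinearMap ℂ (fun _ : Fin m => Fin N → ℂ) X) (P : (Fin N → ℂ) → X) : Prop :=
  (∀ (σ : Equiv.Perm (Fin m)) (z : Fin m → Fin N → ℂ), T (fun j => z (σ j)) = T z) ∧
    ∀ z : Fin N → ℂ, T (fun _ => z) = P z

end

/-! For vectors `x_k`, cotype followed by the Kahane inequality gives the one-variable estimate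
(∑‖x_k‖^q)^(1/q) ≤ C_q K ∫‖∑ x_k z_k‖ dz. Freezing all indices but one and iterating, with
Minkowski's inequality exchanging the ℓ^q sum and the integral, costs one factor C_q K per variable
(`rpow_sum_norm_coeff_le`). It bounds the coefficients of T by (C_q K)^m times the L¹ norm of T over
m independent points of the torus.

It remains to compare T with P in L¹, with constant m^m/m! (`IsSymmetrization.integral_norm_le`).
Polarization writes 2^m m! T(z) as a signed sum of the 2^m values P(∑ ε_j z_j). Since (1/m)∑ ε_j z_j
lies in the closed polydisc and its law is invariant under torus rotations, homogeneity and the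
maximum modulus principle bound the mean of each term by m^m ∫‖P‖.

C_q and K are infima, so they must themselves be shown admissible. For K this needs some finite
Kahane constant: the sharp comparison of moments for signs, transferred to the circle by rotation
invariance and the contraction principle, gives 6. -/

noncomputable section

/-! ### Averages over the sign cube -/

/-- The mean of a real function over the sign cube `{±1}^n`. -/
def signMean {n : ℕ} (f : (Fin n → ℤˣ) → ℝ) : ℝ := (∑ ε, f ε) / 2 ^ n

/-- The sign vector `ε` with its `k`-th sign reversed. -/
def signFlip {n : ℕ} (k : Fin n) (ε : Fin n → ℤˣ) : Fin n → ℤˣ := Function.update ε k (-ε k)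

namespace signMean

variable {n : ℕ} {f g : (Fin n → ℤˣ) → ℝ}

theorem add (f g : (Fin n → ℤˣ) → ℝ) :
    signMean (fun ε => f ε + g ε) = signMean f + signMean g := by
  simp only [signMean, Finset.sum_add_distrib, add_div]

theorem sub (f g : (Fin n → ℤˣ) → ℝ) :
    signMean (fun ε => f ε - g ε) = signMean f - signMean g := by
  simp only [signMean, Finset.sum_sub_distrib, sub_div]

theorem const_mul (c : ℝ) (f : (Fin n → ℤˣ) → ℝ) :
    signMean (fun ε => c * f ε) = c * signMean f := by
  simp only [signMean, ← Finset.mul_sum, mul_div_assoc]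

theorem const (c : ℝ) : signMean (fun _ : Fin n → ℤˣ => c) = c := by
  simp [signMean]

theorem mono (h : ∀ ε, f ε ≤ g ε) : signMean f ≤ signMean g := by
  unfold signMean
  have := Finset.sum_le_sum fun ε (_ : ε ∈ Finset.univ) => h ε
  gcongr

theorem nonneg (h : ∀ ε, 0 ≤ f ε) : 0 ≤ signMean f := by
  simpa [const] using mono (f := fun _ => 0) h

theorem sum {ι : Type*} (s : Finset ι) (F : ι → (Fin n → ℤˣ) → ℝ) :
    signMean (fun ε => ∑ i ∈ s, F i ε) = ∑ i ∈ s, signMean (F i) := by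
  simp only [signMean, ← Finset.sum_div]
  rw [Finset.sum_comm]

theorem comp_equiv (e : (Fin n → ℤˣ) ≃ (Fin n → ℤˣ)) (f : (Fin n → ℤˣ) → ℝ) :
    signMean (fun ε => f (e ε)) = signMean f := by
  unfold signMean
  rw [Equiv.sum_comp e f]

theorem comp_mul (δ : Fin n → ℤˣ) (f : (Fin n → ℤˣ) → ℝ) :
    signMean (fun ε => f (fun k => δ k * ε k)) = signMean f :=
  comp_equiv (Equiv.mulLeft δ) f

theorem comp_signFlip (k : Fin n) (f : (Fin n → ℤˣ) → ℝ) :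
    signMean (fun ε => f (signFlip k ε)) = signMean f := by
  have hinv : Function.Involutive (signFlip k) := fun ε => by simp [signFlip]
  exact comp_equiv hinv.toPerm f

theorem succ (f : (Fin (n + 1) → ℤˣ) → ℝ) :
    signMean f = (signMean (fun ε => f (Fin.cons 1 ε)) +
      signMean (fun ε => f (Fin.cons (-1) ε))) / 2 := by
  have h : ∑ ε, f ε = ∑ p : ℤˣ × (Fin n → ℤˣ), f (Fin.cons p.1 p.2) :=
    (Equiv.sum_comp (Fin.consEquiv fun _ => ℤˣ) f).symm
  simp only [signMean]
  rw [h, Fintype.sum_prod_type, UnitsInt.univ, Finset.sum_pair (by decide)]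
  field_simp
  ring

theorem sq_le (f : (Fin n → ℤˣ) → ℝ) : signMean f ^ 2 ≤ signMean (fun ε => f ε ^ 2) := by
  have h := nonneg (f := fun ε => (f ε - signMean f) ^ 2) fun ε => sq_nonneg _
  have e : (fun ε => (f ε - signMean f) ^ 2) =
      fun ε => f ε ^ 2 + ((-2 * signMean f) * f ε + signMean f ^ 2) := by
    funext ε; ring
  rw [e, add, add (fun ε => _ * f ε), const_mul, const] at h
  linarith

end signMean

@[simp] theorem signFlip_zero_cons {n : ℕ} (u : ℤˣ) (ε : Fin n → ℤˣ) :
    signFlip 0 (Fin.cons u ε : Fin (n + 1) → ℤˣ) = Fin.cons (-u) ε := by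
  simp [signFlip, Fin.update_cons_zero]

@[simp] theorem signFlip_succ_cons {n : ℕ} (u : ℤˣ) (k : Fin n) (ε : Fin n → ℤˣ) :
    signFlip k.succ (Fin.cons u ε : Fin (n + 1) → ℤˣ) = Fin.cons u (signFlip k ε) := by
  simp [signFlip, Fin.cons_update]

/-! ### Poincaré inequalities on the sign cube -/

/-- The Dirichlet form of the sign cube. -/
def signEnergy {n : ℕ} (f : (Fin n → ℤˣ) → ℝ) : ℝ :=
  ∑ k, signMean (fun ε => ((f ε - f (signFlip k ε)) / 2) ^ 2)

theorem signMean_sq_succ {n : ℕ} (f : (Fin (n + 1) → ℤˣ) → ℝ) :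
    signMean (fun ε => f ε ^ 2) =
      signMean (fun ε => ((f (Fin.cons 1 ε) + f (Fin.cons (-1) ε)) / 2) ^ 2) +
      signMean (fun ε => ((f (Fin.cons 1 ε) - f (Fin.cons (-1) ε)) / 2) ^ 2) := by
  rw [signMean.succ, ← signMean.add, ← signMean.add, div_eq_inv_mul, ← signMean.const_mul]
  congr 1; funext ε; ring

theorem signEnergy_succ {n : ℕ} (f : (Fin (n + 1) → ℤˣ) → ℝ) :
    signEnergy f =
      signMean (fun ε => ((f (Fin.cons 1 ε) - f (Fin.cons (-1) ε)) / 2) ^ 2) +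
      (signEnergy (fun ε => (f (Fin.cons 1 ε) + f (Fin.cons (-1) ε)) / 2) +
      signEnergy (fun ε => (f (Fin.cons 1 ε) - f (Fin.cons (-1) ε)) / 2)) := by
  unfold signEnergy
  rw [Fin.sum_univ_succ, ← Finset.sum_add_distrib]
  congr 1
  · rw [signMean.succ, ← signMean.add, div_eq_inv_mul, ← signMean.const_mul]
    congr 1; funext ε
    simp only [signFlip_zero_cons, neg_neg]
    ring
  · refine Finset.sum_congr rfl fun k _ => ?_
    rw [signMean.succ, ← signMean.add, ← signMean.add, div_eq_inv_mul, ← signMean.const_mul]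
    congr 1; funext ε
    simp only [signFlip_succ_cons]
    ring

/-- The Poincaré inequality, by induction on the dimension: f is split into its even and odd parts
in the first sign, for which both second moments and energies add up. -/
theorem signMean_variance_le_energy {n : ℕ} (f : (Fin n → ℤˣ) → ℝ) :
    signMean (fun ε => f ε ^ 2) - signMean f ^ 2 ≤ signEnergy f := by
  induction n with
  | zero => simp [signMean, signEnergy]
  | succ n ih =>
    rw [signMean_sq_succ, signEnergy_succ]
    have h1 := ih (fun ε => (f (Fin.cons 1 ε) + f (Fin.cons (-1) ε)) / 2)
    have h2 := ih (fun ε => (f (Fin.cons 1 ε) - f (Fin.cons (-1) ε)) / 2)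
    -- Together with the previous inequality, this shows that the energy of the odd part is
    -- nonnegative.
    have h3 := signMean.sq_le (fun ε => (f (Fin.cons 1 ε) - f (Fin.cons (-1) ε)) / 2)
    have h4 : signMean f = signMean (fun ε => (f (Fin.cons 1 ε) + f (Fin.cons (-1) ε)) / 2) := by
      rw [signMean.succ, ← signMean.add, div_eq_inv_mul, ← signMean.const_mul]
      congr 1; funext ε; ring
    rw [h4]
    linarith

/-- In Walsh coefficients the energy is ∑ |S| f̂(S)², so every level |S| ≥ 2 counts at least twice,
and level one exactly once. The subtracted sum is the level-one weight. The induction avoids the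
Walsh expansion: the odd part needs only the ordinary Poincaré inequality, its mean being the
level-one coefficient of the first sign. -/
theorem two_mul_signMean_variance_le {n : ℕ} (f : (Fin n → ℤˣ) → ℝ) :
    2 * signMean (fun ε => f ε ^ 2) - 2 * signMean f ^ 2 -
      ∑ k, signMean (fun ε => ((ε k : ℤ) : ℝ) * f ε) ^ 2 ≤ signEnergy f := by
  induction n with
  | zero => simp [signMean, signEnergy]
  | succ n ih =>
    rw [signMean_sq_succ, signEnergy_succ, Fin.sum_univ_succ]
    have h1 := ih (fun ε => (f (Fin.cons 1 ε) + f (Fin.cons (-1) ε)) / 2)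
    have h2 := signMean_variance_le_energy
      (fun ε => (f (Fin.cons 1 ε) - f (Fin.cons (-1) ε)) / 2)
    have h4 : signMean f = signMean (fun ε => (f (Fin.cons 1 ε) + f (Fin.cons (-1) ε)) / 2) := by
      rw [signMean.succ, ← signMean.add, div_eq_inv_mul, ← signMean.const_mul]
      congr 1; funext ε; ring
    have h5 : signMean (fun ε => ((ε 0 : ℤ) : ℝ) * f ε) =
        signMean (fun ε => (f (Fin.cons 1 ε) - f (Fin.cons (-1) ε)) / 2) := by
      rw [signMean.succ, ← signMean.add, div_eq_inv_mul, ← signMean.const_mul]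
      congr 1; funext ε
      simp only [Fin.cons_zero, Units.val_one, Units.val_neg, Int.cast_neg, Int.cast_one]
      ring
    have h6 : ∀ k : Fin n, signMean (fun ε => ((ε k.succ : ℤ) : ℝ) * f ε) =
        signMean (fun ε => ((ε k : ℤ) : ℝ) *
          ((f (Fin.cons 1 ε) + f (Fin.cons (-1) ε)) / 2)) := by
      intro k
      rw [signMean.succ, ← signMean.add, div_eq_inv_mul, ← signMean.const_mul]
      congr 1; funext ε
      simp only [Fin.cons_succ]
      ring
    rw [h4, h5]
    simp only [h6]
    linarith

/-! ### Moment comparison and contraction for sign sums -/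

section

variable {Y : Type*} [NormedAddCommGroup Y] [NormedSpace ℝ Y]

theorem signSum_signFlip {n : ℕ} (x : Fin n → Y) (k : Fin n) (ε : Fin n → ℤˣ) :
    ∑ j, ((signFlip k ε j : ℤ) : ℝ) • x j =
      ∑ j, ((ε j : ℤ) : ℝ) • x j - (2 : ℝ) • (((ε k : ℤ) : ℝ) • x k) := by
  have h : ∀ j, ((signFlip k ε j : ℤ) : ℝ) • x j = ((ε j : ℤ) : ℝ) • x j -
      if j = k then (2 : ℝ) • (((ε k : ℤ) : ℝ) • x k) else 0 := by
    intro j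
    rcases eq_or_ne j k with rfl | hj
    · simp only [signFlip, Function.update_self, Units.val_neg, Int.cast_neg, if_true]
      module
    · simp [signFlip, hj]
  simp [h, Finset.sum_sub_distrib]

/-- The Khinchine–Kahane inequality for signs, by the argument of Latała and Oleszkiewicz. -/
theorem signMean_norm_sq_le {n : ℕ} (x : Fin n → Y) :
    signMean (fun ε => ‖∑ j, ((ε j : ℤ) : ℝ) • x j‖ ^ 2) ≤
      2 * signMean (fun ε => ‖∑ j, ((ε j : ℤ) : ℝ) • x j‖) ^ 2 := by
  set f : (Fin n → ℤˣ) → ℝ := fun ε => ‖∑ j, ((ε j : ℤ) : ℝ) • x j‖ with hf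
  -- The norm of a sign sum is even, so its level-one coefficients vanish and the improved Poincaré
  -- inequality has constant 2.
  have heven : ∀ ε, f (fun k => -1 * ε k) = f ε := by
    intro ε
    simp [hf, Finset.sum_neg_distrib]
  have hdeg : ∀ k, signMean (fun ε => ((ε k : ℤ) : ℝ) * f ε) = 0 := by
    intro k
    have h := signMean.comp_mul (fun _ => -1) (fun ε => ((ε k : ℤ) : ℝ) * f ε)
    simp only [heven] at h
    have e : (fun ε : Fin n → ℤˣ => (((-1 * ε k : ℤˣ) : ℤ) : ℝ) * f ε) =
        fun ε => (-1) * (((ε k : ℤ) : ℝ) * f ε) := by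
      funext ε; simp
    rw [e, signMean.const_mul] at h
    linarith
  -- Flipping the k-th sign subtracts 2 ε_k x_k, so the n flipped sums add up to n - 2 times the
  -- original; then the triangle inequality applies.
  have hlower : ∀ ε, ((n : ℝ) - 2) * f ε ≤ ∑ k, f (signFlip k ε) := by
    intro ε
    have h1 : ∑ k, ∑ j, ((signFlip k ε j : ℤ) : ℝ) • x j =
        ((n : ℝ) - 2) • ∑ j, ((ε j : ℤ) : ℝ) • x j := by
      simp only [signSum_signFlip, Finset.sum_sub_distrib, ← Finset.smul_sum, Finset.sum_const,
        Finset.card_univ, Fintype.card_fin, sub_smul, Nat.cast_smul_eq_nsmul]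
    calc ((n : ℝ) - 2) * f ε ≤ |(n : ℝ) - 2| * f ε := by
          gcongr
          exact le_abs_self _
      _ = ‖∑ k, ∑ j, ((signFlip k ε j : ℤ) : ℝ) • x j‖ := by
          rw [h1, norm_smul, Real.norm_eq_abs]
      _ ≤ _ := norm_sum_le _ _
  -- The energy is half the mean of n f² - f ∑ f(flip), and the previous bound leaves (n - (n -
  -- 2))/2 = 1 as the factor of f².
  have henergy : signEnergy f ≤ signMean (fun ε => f ε ^ 2) := by
    have h1 : ∀ k, signMean (fun ε => ((f ε - f (signFlip k ε)) / 2) ^ 2) =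
        signMean (fun ε => (1 / 2) * (f ε ^ 2 - f ε * f (signFlip k ε))) := by
      intro k
      have h2 := signMean.comp_signFlip k (fun ε => f ε ^ 2)
      have e : (fun ε => ((f ε - f (signFlip k ε)) / 2) ^ 2) =
          fun ε => (1 / 4) * f ε ^ 2 + ((1 / 4) * f (signFlip k ε) ^ 2 +
            (-1 / 2) * (f ε * f (signFlip k ε))) := by
        funext ε; ring
      rw [e, signMean.add, signMean.add, signMean.const_mul, signMean.const_mul,
        signMean.const_mul, signMean.const_mul, signMean.sub, h2]
      ring
    unfold signEnergy
    simp only [h1]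
    rw [← signMean.sum]
    refine signMean.mono fun ε => ?_
    have h3 : ∑ k, (1 / 2 : ℝ) * (f ε ^ 2 - f ε * f (signFlip k ε)) =
        1 / 2 * (n * f ε ^ 2 - f ε * ∑ k, f (signFlip k ε)) := by
      rw [← Finset.mul_sum, Finset.sum_sub_distrib, ← Finset.mul_sum]
      simp
    rw [h3]
    have h4 := mul_le_mul_of_nonneg_left (hlower ε) (norm_nonneg _ : 0 ≤ f ε)
    nlinarith
  have h := two_mul_signMean_variance_le f
  simp only [hdeg] at h
  simp only [ne_eq, OfNat.ofNat_ne_zero, not_false_eq_true, zero_pow, Finset.sum_const_zero] at h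
  linarith

/-- The contraction principle for signs. -/
theorem signMean_norm_smul_le {n : ℕ} (x : Fin n → Y) (t : Fin n → ℝ) (ht : ∀ k, |t k| ≤ 1) :
    signMean (fun ε => ‖∑ j, ((ε j : ℤ) : ℝ) • t j • x j‖) ≤
      signMean (fun ε => ‖∑ j, ((ε j : ℤ) : ℝ) • x j‖) := by
  have hconv : ConvexOn ℝ Set.univ
      (fun t : Fin n → ℝ => signMean (fun ε => ‖∑ j, ((ε j : ℤ) : ℝ) • t j • x j‖)) := by
    refine ⟨convex_univ, fun s _ t _ a b ha hb _ => ?_⟩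
    simp only [smul_eq_mul]
    rw [← signMean.const_mul, ← signMean.const_mul, ← signMean.add]
    refine signMean.mono fun ε => ?_
    have e : ∑ j, ((ε j : ℤ) : ℝ) • (a • s + b • t) j • x j =
        a • ∑ j, ((ε j : ℤ) : ℝ) • s j • x j + b • ∑ j, ((ε j : ℤ) : ℝ) • t j • x j := by
      rw [Finset.smul_sum, Finset.smul_sum, ← Finset.sum_add_distrib]
      refine Finset.sum_congr rfl fun j _ => ?_
      simp only [Pi.add_apply, Pi.smul_apply, smul_eq_mul]
      module
    rw [e]
    refine (norm_add_le _ _).trans_eq ?_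
    rw [norm_smul, norm_smul, Real.norm_of_nonneg ha, Real.norm_of_nonneg hb]
  -- A convex function on the cube [-1,1]^n is dominated by its value at some vertex; a vertex is a
  -- sign vector, which the mean over all signs absorbs.
  have hmem : t ∈ convexHull ℝ (Set.univ.pi fun _ : Fin n => ({-1, 1} : Set ℝ)) := by
    rw [convexHull_pi]
    intro k _
    rw [convexHull_pair, segment_eq_Icc (by norm_num)]
    exact abs_le.1 (ht k)
  obtain ⟨y, hy, hle⟩ := hconv.exists_ge_of_mem_convexHull (Set.subset_univ _) hmem
  refine hle.trans_eq ?_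
  have hδ : ∀ k, ∃ δ : ℤˣ, ((δ : ℤ) : ℝ) = y k := by
    intro k
    rcases hy k (Set.mem_univ k) with h | h
    · exact ⟨-1, by simp [h]⟩
    · exact ⟨1, by simp [Set.mem_singleton_iff.1 h]⟩
  choose δ hδ using hδ
  rw [← signMean.comp_mul δ (fun ε => ‖∑ j, ((ε j : ℤ) : ℝ) • x j‖)]
  congr 1; funext ε
  congr 1
  refine Finset.sum_congr rfl fun j _ => ?_
  rw [← hδ, smul_smul, Units.val_mul, Int.cast_mul, mul_comm]

end

/-- Real and imaginary parts of the multipliers are contracted separately, whence the factor 2. -/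
theorem signMean_norm_complex_smul_le {Y : Type*} [NormedAddCommGroup Y] [NormedSpace ℂ Y]
    {n : ℕ} (x : Fin n → Y) (w : Fin n → ℂ) (hw : ∀ k, ‖w k‖ ≤ 1) :
    signMean (fun ε => ‖∑ j, ((ε j : ℤ) : ℝ) • w j • x j‖) ≤
      2 * signMean (fun ε => ‖∑ j, ((ε j : ℤ) : ℝ) • x j‖) := by
  have h1 := signMean_norm_smul_le x (fun k => (w k).re)
    fun k => (Complex.abs_re_le_norm _).trans (hw k)
  have h2 := signMean_norm_smul_le x (fun k => (w k).im)
    fun k => (Complex.abs_im_le_norm _).trans (hw k)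
  have h3 : signMean (fun ε => ‖∑ j, ((ε j : ℤ) : ℝ) • w j • x j‖) ≤
      signMean (fun ε => ‖∑ j, ((ε j : ℤ) : ℝ) • (w j).re • x j‖ +
        ‖∑ j, ((ε j : ℤ) : ℝ) • (w j).im • x j‖) := by
    refine signMean.mono fun ε => ?_
    have e : ∑ j, ((ε j : ℤ) : ℝ) • w j • x j = ∑ j, ((ε j : ℤ) : ℝ) • (w j).re • x j +
        Complex.I • ∑ j, ((ε j : ℤ) : ℝ) • (w j).im • x j := by
      rw [Finset.smul_sum, ← Finset.sum_add_distrib]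
      refine Finset.sum_congr rfl fun j _ => ?_
      conv_lhs => rw [← Complex.re_add_im (w j)]
      rw [add_smul, smul_add, mul_comm, mul_smul, Complex.coe_smul, Complex.coe_smul,
        smul_comm Complex.I ((ε j : ℤ) : ℝ), smul_comm Complex.I (w j).im]
    rw [e]
    refine (norm_add_le _ _).trans_eq ?_
    rw [norm_smul, Complex.norm_I, one_mul]
  rw [signMean.add] at h3
  linarith

/-! ### Rotation invariance on the circle and the torus -/

theorem Continuous.integrable_of_compactSpace {α E : Type*} [TopologicalSpace α] [CompactSpace α]
    [MeasurableSpace α] [OpensMeasurableSpace α] [NormedAddCommGroup E] {μ : Measure α}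
    [IsFiniteMeasure μ] {f : α → E} (hf : Continuous f) : Integrable f μ :=
  hf.integrable_of_hasCompactSupport (HasCompactSupport.of_compactSpace f)

theorem integral_circleLebesgue {f : Circle → ℝ} (hf : Continuous f) :
    ∫ w, f w ∂circleLebesgue =
      (2 * Real.pi)⁻¹ * ∫ t in (0 : ℝ)..(2 * Real.pi), f (Circle.exp t) := by
  have hpos : 0 ≤ 2 * Real.pi := by positivity
  rw [circleLebesgue, integral_map Circle.exp.continuous.aemeasurable
    hf.aestronglyMeasurable, integral_smul_measure, intervalIntegral.integral_of_le hpos,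
    ENNReal.toReal_inv, ENNReal.toReal_ofReal hpos, smul_eq_mul]

/-- A finite Borel measure is determined by its integrals of bounded continuous functions, and the
integral of a periodic function over one period does not depend on the starting point. -/
theorem measurePreserving_mul_circleLebesgue (u : Circle) :
    MeasurePreserving (fun w => u * w) circleLebesgue circleLebesgue := by
  refine ⟨measurable_const_mul u, ?_⟩
  have : IsProbabilityMeasure (Measure.map (fun w => u * w) circleLebesgue) :=
    Measure.isProbabilityMeasure_map (measurable_const_mul u).aemeasurable
  refine ext_of_forall_integral_eq_of_IsFiniteMeasure fun f => ?_
  have hu : Continuous fun w : Circle => u * w := continuous_const.mul continuous_id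
  rw [integral_map hu.aemeasurable f.continuous.aestronglyMeasurable,
    integral_circleLebesgue (f := fun w => f (u * w)) (f.continuous.comp hu), integral_circleLebesgue f.continuous]
  congr 1
  obtain ⟨s, rfl⟩ := Circle.exp_surjective u
  have hper : Function.Periodic (fun t : ℝ => f (Circle.exp t)) (2 * Real.pi) := fun t => by
    simp only [Circle.periodic_exp t]
  have h1 : ∫ t in (0 : ℝ)..(2 * Real.pi), f (Circle.exp s * Circle.exp t) =
      ∫ t in (0 : ℝ)..(2 * Real.pi), f (Circle.exp (s + t)) := by
    simp only [Circle.exp_add]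
  rw [h1, intervalIntegral.integral_comp_add_left (fun t => f (Circle.exp t)), add_zero,
    hper.intervalIntegral_add_eq s 0, zero_add]

theorem measurePreserving_mul_torusLebesgue {N : ℕ} (u : Fin N → Circle) :
    MeasurePreserving (fun z => u * z) (torusLebesgue N) (torusLebesgue N) :=
  measurePreserving_pi _ _ fun k => measurePreserving_mul_circleLebesgue (u k)

theorem measurePreserving_mul_pi_torusLebesgue {N m : ℕ} (u : Fin m → Fin N → Circle) :
    MeasurePreserving (fun z => u * z) (Measure.pi fun _ : Fin m => torusLebesgue N)
      (Measure.pi fun _ : Fin m => torusLebesgue N) :=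
  measurePreserving_pi _ _ fun k => measurePreserving_mul_torusLebesgue (u k)

theorem integral_torusLebesgue_mul {N : ℕ} {E : Type*} [NormedAddCommGroup E] [NormedSpace ℝ E]
    (u : Fin N → Circle) (f : (Fin N → Circle) → E) :
    ∫ z, f (u * z) ∂torusLebesgue N = ∫ z, f z ∂torusLebesgue N :=
  (measurePreserving_mul_torusLebesgue u).integral_comp
    (MeasurableEquiv.mulLeft u).measurableEmbedding f

theorem integral_pi_torusLebesgue_mul {N m : ℕ} {E : Type*} [NormedAddCommGroup E]
    [NormedSpace ℝ E] (u : Fin m → Fin N → Circle) (f : (Fin m → Fin N → Circle) → E) :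
    ∫ z, f (u * z) ∂(Measure.pi fun _ : Fin m => torusLebesgue N) =
      ∫ z, f z ∂(Measure.pi fun _ : Fin m => torusLebesgue N) :=
  (measurePreserving_mul_pi_torusLebesgue u).integral_comp
    (MeasurableEquiv.mulLeft u).measurableEmbedding f

/-- The circle element with the value of the sign `u`. -/
def signCircle (u : ℤˣ) : Circle := if u = 1 then 1 else -1

theorem coe_signCircle (u : ℤˣ) : (signCircle u : ℂ) = (((u : ℤ) : ℝ) : ℂ) := by
  rcases Int.units_eq_one_or u with rfl | rfl <;> simp [signCircle]

/-! ### From signs to the torus: a finite Kahane constant -/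

section Kahane

variable {Y : Type*} [NormedAddCommGroup Y] [NormedSpace ℂ Y] {N : ℕ} (x : Fin N → Y)

/-- Integrals of norms of Steinhaus sums are averages of sign means. -/
theorem integral_torusSum_eq_integral_signMean (g : ℝ → ℝ) (hg : Continuous g) :
    ∫ z, g ‖∑ k, (z k : ℂ) • x k‖ ∂torusLebesgue N =
      ∫ z, signMean (fun ε => g ‖∑ k, ((ε k : ℤ) : ℝ) • (z k : ℂ) • x k‖) ∂torusLebesgue N := by
  -- Multiplying by a sign vector is a rotation of the torus, so each of the 2^N terms has the same
  -- integral.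
  have h : ∀ ε : Fin N → ℤˣ,
      ∫ z : Fin N → Circle, g ‖∑ k, ((ε k : ℤ) : ℝ) • (z k : ℂ) • x k‖ ∂torusLebesgue N =
      ∫ z, g ‖∑ k, (z k : ℂ) • x k‖ ∂torusLebesgue N := by
    intro ε
    rw [← integral_torusLebesgue_mul (fun k => signCircle (ε k))
      (fun z => g ‖∑ k, (z k : ℂ) • x k‖)]
    congr 1; funext z
    simp only [Pi.mul_apply, Circle.coe_mul, coe_signCircle, mul_smul, Complex.coe_smul]
  unfold signMean
  rw [integral_div, integral_finsetSum]
  · simp only [h]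
    simp
  · intro ε _
    apply Continuous.integrable_of_compactSpace
    fun_prop

/-- For each fixed z, complex contraction with multipliers z_k⁻¹ recovers x_k from z_k x_k at the
cost of a factor 2; integrating over z gives the claim. -/
theorem signMean_le_two_mul_integral_torusSum :
    signMean (fun ε => ‖∑ k, ((ε k : ℤ) : ℝ) • x k‖) ≤
      2 * ∫ z, ‖∑ k, (z k : ℂ) • x k‖ ∂torusLebesgue N := by
  have heq := integral_torusSum_eq_integral_signMean x id continuous_id
  simp only [id] at heq
  rw [heq, ← integral_const_mul]
  have h : ∫ _ : Fin N → Circle, signMean (fun ε => ‖∑ k, ((ε k : ℤ) : ℝ) • x k‖)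
      ∂torusLebesgue N = signMean (fun ε => ‖∑ k, ((ε k : ℤ) : ℝ) • x k‖) := by simp
  rw [← h]
  refine integral_mono (integrable_const _) ?_ fun z => ?_
  · apply Continuous.integrable_of_compactSpace
    unfold signMean
    fun_prop
  · have h2 := signMean_norm_complex_smul_le (fun k => (z k : ℂ) • x k)
      (fun k => ((z k)⁻¹ : Circle)) (fun k => (Circle.norm_coe _).le)
    refine le_of_eq_of_le ?_ h2
    congr 1; funext ε
    congr 1
    refine Finset.sum_congr rfl fun k _ => ?_
    rw [smul_smul ((_ : Circle) : ℂ), ← Circle.coe_mul, inv_mul_cancel, Circle.coe_one, one_smul]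

theorem integral_torusSum_sq_le :
    ∫ z, ‖∑ k, (z k : ℂ) • x k‖ ^ 2 ∂torusLebesgue N ≤
      (6 * ∫ z, ‖∑ k, (z k : ℂ) • x k‖ ∂torusLebesgue N) ^ 2 := by
  set A := signMean (fun ε => ‖∑ k, ((ε k : ℤ) : ℝ) • x k‖) with hA
  have hA0 : 0 ≤ A := signMean.nonneg fun _ => norm_nonneg _
  have hle := signMean_le_two_mul_integral_torusSum x
  -- Here 8 = 2 · 2²: the moment comparison for signs, then complex contraction squared. As A is at
  -- most twice the L¹ norm, the final constant is 32 ≤ 6².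
  have h : ∫ z, ‖∑ k, (z k : ℂ) • x k‖ ^ 2 ∂torusLebesgue N ≤
      ∫ _, 8 * A ^ 2 ∂torusLebesgue N := by
    rw [integral_torusSum_eq_integral_signMean x (fun r => r ^ 2) (by fun_prop)]
    refine integral_mono ?_ (integrable_const _) fun z => ?_
    · apply Continuous.integrable_of_compactSpace
      unfold signMean
      fun_prop
    · have h1 := signMean_norm_sq_le (fun k => (z k : ℂ) • x k)
      have h2 := signMean_norm_complex_smul_le x (fun k => z k) (fun k => (Circle.norm_coe _).le)
      have h3 : 0 ≤ signMean (fun ε => ‖∑ k, ((ε k : ℤ) : ℝ) • (z k : ℂ) • x k‖) :=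
        signMean.nonneg fun _ => norm_nonneg _
      simp only at h1 ⊢
      nlinarith
  simp only [integral_const, probReal_univ, one_smul] at h
  nlinarith

end Kahane

/-- The value 6 is immaterial; it shows that the set defining `kahaneConst` is nonempty, so that its
infimum is meaningful. -/
theorem isKahaneConstant_six : IsKahaneConstant.{u} 6 := by
  refine ⟨by norm_num, fun Y _ _ _ N x => ?_⟩
  rw [← Real.sqrt_eq_rpow]
  exact Real.sqrt_le_iff.2 ⟨by positivity, integral_torusSum_sq_le x⟩

/-! ### The best constants are admissible -/

theorem le_sInf_mul {S : Set ℝ} (hS : S.Nonempty) {L I : ℝ} (hI : 0 ≤ I)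
    (h : ∀ K ∈ S, L ≤ K * I) : L ≤ sInf S * I := by
  rcases hI.eq_or_lt with rfl | hI
  · obtain ⟨K, hK⟩ := hS
    simpa using h K hK
  · rw [← div_le_iff₀ hI]
    exact le_csInf hS fun K hK => (div_le_iff₀ hI).2 (h K hK)

theorem isKahaneConstant_kahaneConst : IsKahaneConstant.{u} kahaneConst.{u} := by
  have hne : {K : ℝ | IsKahaneConstant.{u} K}.Nonempty := ⟨6, isKahaneConstant_six⟩
  refine ⟨le_csInf hne fun K hK => hK.1, fun Y _ _ _ N x => ?_⟩
  exact le_sInf_mul hne (integral_nonneg fun _ => norm_nonneg _) fun K hK => hK.2 Y N x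

theorem HasCotype.isCotypeConstant_cotypeConst {X : Type*} [NormedAddCommGroup X]
    [NormedSpace ℂ X] {q : ℝ} (hX : HasCotype X q) : IsCotypeConstant X q (cotypeConst X q) := by
  have hne : {C : ℝ | IsCotypeConstant X q C}.Nonempty := hX
  refine ⟨le_csInf hne fun C hC => hC.1, fun N x => ?_⟩
  exact le_sInf_mul hne (Real.rpow_nonneg (integral_nonneg fun _ => by positivity) _)
    fun C hC => hC.2 N x

/-! ### Iterating the one-variable estimate -/

/-- Minkowski's inequality for finite `ℓ^q` sums of integrals. -/
theorem rpow_sum_integral_le {Ω ι : Type*} [MeasurableSpace Ω] {μ : Measure Ω} [Fintype ι] {q : ℝ}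
    (hq : 1 ≤ q) {G : ι → Ω → ℝ} (hG : ∀ k, Integrable (G k) μ) (h0 : ∀ k ω, 0 ≤ G k ω) :
    (∑ k, (∫ ω, G k ω ∂μ) ^ q) ^ (1 / q) ≤ ∫ ω, (∑ k, G k ω ^ q) ^ (1 / q) ∂μ := by
  have hq0 : 0 ≤ q := by linarith
  have : Fact (1 ≤ ENNReal.ofReal q) := ⟨by simpa using hq⟩
  have hpq : (ENNReal.ofReal q).toReal = q := ENNReal.toReal_ofReal hq0
  have hpos : 0 < (ENNReal.ofReal q).toReal := by rw [hpq]; linarith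
  -- Minkowski's inequality is the bound of the norm of an integral by the integral of the norm,
  -- applied to this ℓ^q-valued function.
  let v : Ω → PiLp (ENNReal.ofReal q) (fun _ : ι => ℝ) := fun ω => WithLp.toLp _ fun k => G k ω
  have hnorm : ∀ ω, ‖v ω‖ = (∑ k, G k ω ^ q) ^ (1 / q) := by
    intro ω
    rw [PiLp.norm_eq_sum hpos, hpq]
    simp [v, abs_of_nonneg (h0 _ ω)]
  have hint : ‖∫ ω, v ω ∂μ‖ = (∑ k, (∫ ω, G k ω ∂μ) ^ q) ^ (1 / q) := by
    rw [PiLp.norm_eq_sum hpos, hpq]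
    congr 1
    refine Finset.sum_congr rfl fun k _ => ?_
    rw [eval_integral_piLp hG, Real.norm_of_nonneg (integral_nonneg (h0 k))]
  rw [← hint]
  simp only [← hnorm]
  exact norm_integral_le_integral_norm v

theorem integral_pi_torusLebesgue_succ {N m : ℕ} {E : Type*} [NormedAddCommGroup E]
    [NormedSpace ℝ E] {F : (Fin (m + 1) → Fin N → Circle) → E} (hF : Continuous F) :
    ∫ z, F z ∂(Measure.pi fun _ : Fin (m + 1) => torusLebesgue N) =
      ∫ z, ∫ w, F (Fin.cons w z) ∂torusLebesgue N
        ∂(Measure.pi fun _ : Fin m => torusLebesgue N) := by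
  have h := (measurePreserving_piFinSuccAbove (fun _ : Fin (m + 1) => torusLebesgue N) 0).symm
  rw [← h.integral_comp' F]
  have hc : Continuous fun p : (Fin N → Circle) × (Fin m → Fin N → Circle) =>
      F (Fin.cons p.1 p.2) := hF.comp (Continuous.finCons continuous_fst continuous_snd)
  have e : ∀ p : (Fin N → Circle) × (Fin m → Fin N → Circle),
      (MeasurableEquiv.piFinSuccAbove (fun _ : Fin (m + 1) => Fin N → Circle) 0).symm p =
        Fin.cons p.1 p.2 := by
    intro p
    simp only [MeasurableEquiv.piFinSuccAbove_symm_apply, Fin.insertNthEquiv_zero]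
    rfl
  simp only [e]
  exact integral_prod_symm _ hc.integrable_of_compactSpace

/-- Iterating a one-variable lower estimate over the variables of a multilinear form. -/
theorem rpow_sum_norm_coeff_le {X : Type*} [NormedAddCommGroup X] [NormedSpace ℂ X] {q D : ℝ}
    (hq : 1 ≤ q) (hD : 0 ≤ D) {N : ℕ}
    (h : ∀ x : Fin N → X, (∑ k, ‖x k‖ ^ q) ^ (1 / q) ≤
      D * ∫ z, ‖∑ k, (z k : ℂ) • x k‖ ∂torusLebesgue N)
    (m : ℕ) (a : (Fin m → Fin N) → X) :
    (∑ i, ‖a i‖ ^ q) ^ (1 / q) ≤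
      D ^ m * ∫ z : Fin m → Fin N → Circle, ‖∑ i, (∏ j, (z j (i j) : ℂ)) • a i‖
        ∂(Measure.pi fun _ : Fin m => torusLebesgue N) := by
  have hq0 : 0 < q := by linarith
  induction m with
  | zero =>
    have h1 : (‖a default‖ ^ q) ^ (1 / q) = ‖a default‖ := by
      rw [← Real.rpow_mul (norm_nonneg _), mul_one_div_cancel hq0.ne', Real.rpow_one]
    simp [-one_div, h1]
  | succ m ih =>
    set ν := Measure.pi fun _ : Fin m => torusLebesgue N
    -- `S k` is the form in the remaining m variables with first index k; the whole form is linear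
    -- in the first variable with coefficients `S k`.
    let S : Fin N → (Fin m → Fin N → Circle) → X := fun k z =>
      ∑ i, (∏ j, (z j (i j) : ℂ)) • a (Fin.cons k i)
    have hS : ∀ k, Continuous (S k) := fun k => by fun_prop
    have hsum : ∑ i, ‖a i‖ ^ q = ∑ k, ∑ i : Fin m → Fin N, ‖a (Fin.cons k i)‖ ^ q := by
      rw [← Fintype.sum_prod_type']
      exact (Equiv.sum_comp (Fin.consEquiv fun _ => Fin N) fun i => ‖a i‖ ^ q).symm
    have hform : ∀ (w : Fin N → Circle) (z : Fin m → Fin N → Circle),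
        ∑ i, (∏ j, ((Fin.cons w z : Fin (m + 1) → Fin N → Circle) j (i j) : ℂ)) • a i =
          ∑ k, (w k : ℂ) • S k z := by
      intro w z
      rw [← Equiv.sum_comp (Fin.consEquiv fun _ => Fin N), Fintype.sum_prod_type]
      refine Finset.sum_congr rfl fun k _ => ?_
      rw [Finset.smul_sum]
      refine Finset.sum_congr rfl fun i _ => ?_
      rw [Fin.prod_univ_succ, smul_smul]
      simp [Fin.consEquiv]
    have hstep : ∀ k, ∑ i : Fin m → Fin N, ‖a (Fin.cons k i)‖ ^ q ≤
        (∫ z, D ^ m * ‖S k z‖ ∂ν) ^ q := by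
      intro k
      have h1 := ih fun i => a (Fin.cons k i)
      rw [integral_const_mul]
      rwa [one_div, Real.rpow_inv_le_iff_of_pos (Finset.sum_nonneg fun _ _ => by positivity)
        (by positivity) hq0] at h1
    rw [hsum, integral_pi_torusLebesgue_succ (by fun_prop)]
    simp only [hform]
    calc (∑ k, ∑ i : Fin m → Fin N, ‖a (Fin.cons k i)‖ ^ q) ^ (1 / q)
        ≤ (∑ k, (∫ z, D ^ m * ‖S k z‖ ∂ν) ^ q) ^ (1 / q) := by
          refine Real.rpow_le_rpow (Finset.sum_nonneg fun _ _ => Finset.sum_nonneg fun _ _ =>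
            by positivity) (Finset.sum_le_sum fun k _ => hstep k) (by positivity)
      -- Minkowski moves the ℓ^q sum over k inside, so that the one-variable estimate can be applied
      -- to the vectors `S k z` for each fixed z.
      _ ≤ ∫ z, (∑ k, (D ^ m * ‖S k z‖) ^ q) ^ (1 / q) ∂ν := by
          refine rpow_sum_integral_le hq (fun k => ?_) fun k z => by positivity
          exact (continuous_const.mul (hS k).norm).integrable_of_compactSpace
      _ ≤ ∫ z, D ^ (m + 1) * ∫ w, ‖∑ k, (w k : ℂ) • S k z‖ ∂torusLebesgue N ∂ν := by
          refine integral_mono ?_ ?_ fun z => ?_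
          · refine Continuous.integrable_of_compactSpace ?_
            refine Continuous.rpow_const (continuous_finsetSum _ fun k _ => ?_)
              fun _ => Or.inr (by positivity)
            exact (continuous_const.mul (hS k).norm).rpow_const fun _ => Or.inr hq0.le
          · refine Integrable.const_mul ?_ _
            have hc : Continuous fun p : (Fin m → Fin N → Circle) × (Fin N → Circle) =>
                ‖∑ k, (p.2 k : ℂ) • S k p.1‖ := by fun_prop
            exact (hc.integrable_of_compactSpace
              (μ := ν.prod (torusLebesgue N))).integral_prod_left
          · have h1 : ∑ k, (D ^ m * ‖S k z‖) ^ q = (D ^ m) ^ q * ∑ k, ‖S k z‖ ^ q := by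
              rw [Finset.mul_sum]
              refine Finset.sum_congr rfl fun k _ => ?_
              rw [Real.mul_rpow (by positivity) (norm_nonneg _)]
            have h2 : (((D ^ m : ℝ)) ^ q) ^ (1 / q) = D ^ m := by
              rw [← Real.rpow_mul (by positivity), mul_one_div_cancel hq0.ne', Real.rpow_one]
            simp only
            rw [h1, Real.mul_rpow (by positivity) (Finset.sum_nonneg fun _ _ => by positivity),
              h2, pow_succ, mul_assoc]
            gcongr
            exact h fun k => S k z
      _ = _ := integral_const_mul _ _

/-! ### Maximum modulus and shrinking radii -/

/-- The maximum modulus principle on the polydisc with respect to its distinguished boundary. -/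
theorem norm_le_of_forall_mem_torus {ι E : Type*} [Fintype ι] [DecidableEq ι]
    [NormedAddCommGroup E] [NormedSpace ℂ E] {F : (ι → ℂ) → E} (hF : Differentiable ℂ F) {M : ℝ}
    (hM : ∀ w : ι → ℂ, (∀ k, ‖w k‖ = 1) → ‖F w‖ ≤ M) {w : ι → ℂ} (hw : ∀ k, ‖w k‖ ≤ 1) :
    ‖F w‖ ≤ M := by
  -- Induction on the set of coordinates allowed inside the disc; the one-variable principle pushes
  -- them to the circle one at a time.
  have key : ∀ (s : Finset ι) (w : ι → ℂ), (∀ k, ‖w k‖ ≤ 1) → (∀ k ∉ s, ‖w k‖ = 1) →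
      ‖F w‖ ≤ M := by
    intro s
    induction s using Finset.induction_on with
    | empty => exact fun w _ hs => hM w fun k => hs k (Finset.notMem_empty k)
    | insert k s _ ih =>
      intro w hw hs
      have hd : Differentiable ℂ fun ζ : ℂ => F (Function.update w k ζ) :=
        hF.comp fun ζ => (hasFDerivAt_update w ζ).differentiableAt
      have h := Complex.norm_le_of_forall_mem_frontier_norm_le
        (Metric.isBounded_ball (x := (0 : ℂ)) (r := 1)) hd.diffContOnCl (C := M) ?_
        (z := w k) ?_
      · simpa using h
      · intro ζ hζ
        rw [frontier_ball _ one_ne_zero, mem_sphere_zero_iff_norm] at hζ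
        refine ih _ (fun j => ?_) fun j hj => ?_
        · rcases eq_or_ne j k with rfl | hjk
          · simp [hζ]
          · simpa [hjk] using hw j
        · rcases eq_or_ne j k with rfl | hjk
          · simp [hζ]
          · simpa [hjk] using hs j (by simp [hjk, hj])
      · rw [closure_ball _ one_ne_zero]
        simpa using hw k
  exact key Finset.univ w hw fun k hk => absurd (Finset.mem_univ k) hk

section

variable {X : Type*} [NormedAddCommGroup X] [NormedSpace ℂ X] {N m : ℕ}
  {c : (Fin N → ℕ) → X} {P : (Fin N → ℂ) → X}

theorem IsHomogeneousPoly.continuous (hP : IsHomogeneousPoly N m c P) : Continuous P := by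
  rw [show P = fun z => _ from funext hP]
  fun_prop

/-- The `L¹` norm over a torus does not increase when the radii shrink. -/
theorem IsHomogeneousPoly.integral_norm_mul_le (hP : IsHomogeneousPoly N m c P) {w : Fin N → ℂ}
    (hw : ∀ k, ‖w k‖ ≤ 1) :
    ∫ z : Fin N → Circle, ‖P (fun k => (z k : ℂ) * w k)‖ ∂torusLebesgue N ≤
      ∫ z, ‖P (fun k => (z k : ℂ))‖ ∂torusLebesgue N := by
  let b : (Fin N → ℕ) → (Fin N → Circle) → X := fun α z => (∏ k, (z k : ℂ) ^ α k) • c α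
  have hb : ∀ α, Integrable (b α) (torusLebesgue N) := fun α =>
    Continuous.integrable_of_compactSpace (by fun_prop)
  -- The integral is the norm of an L¹-valued polynomial in w, to which the vector-valued maximum
  -- principle applies. For unimodular w, rotation invariance identifies that norm with the
  -- right-hand side.
  let F : (Fin N → ℂ) → Lp X 1 (torusLebesgue N) := fun w =>
    ∑ α ∈ Finset.piAntidiag (Finset.univ : Finset (Fin N)) m, (∏ k, w k ^ α k) • (hb α).toL1 (b α)
  have hF : Differentiable ℂ F := by fun_prop
  have hnorm : ∀ w, ‖F w‖ =
      ∫ z : Fin N → Circle, ‖P (fun k => (z k : ℂ) * w k)‖ ∂torusLebesgue N := by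
    intro w
    have hae : (F w : (Fin N → Circle) → X) =ᵐ[torusLebesgue N]
        fun z => P (fun k => (z k : ℂ) * w k) := by
      have h1 := Lp.coeFn_finsetSum (p := 1) (μ := torusLebesgue N)
        (Finset.piAntidiag (Finset.univ : Finset (Fin N)) m)
        (fun α => (∏ k, w k ^ α k) • (hb α).toL1 (b α))
      have h2 : ∀ α, ((((∏ k, w k ^ α k) • (hb α).toL1 (b α) : Lp X 1 (torusLebesgue N))) :
          (Fin N → Circle) → X) =ᵐ[torusLebesgue N] fun z => (∏ k, w k ^ α k) • b α z := by
        intro α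
        filter_upwards [Lp.coeFn_smul (∏ k, w k ^ α k) ((hb α).toL1 (b α)),
          (hb α).coeFn_toL1] with z h3 h4
        rw [h3, Pi.smul_apply, h4]
      have h3 := (Filter.eventually_all_finset
        (Finset.piAntidiag (Finset.univ : Finset (Fin N)) m)).2 fun α _ => h2 α
      filter_upwards [h1, h3] with z h4 h5
      rw [h4, Finset.sum_apply, Finset.sum_congr rfl h5, hP]
      refine Finset.sum_congr rfl fun α _ => ?_
      simp only [b, smul_smul, mul_pow, Finset.prod_mul_distrib, mul_comm]
    rw [L1.norm_eq_integral_norm]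
    exact integral_congr_ae (hae.mono fun z hz => by simp only [hz])
  rw [← hnorm]
  refine norm_le_of_forall_mem_torus hF (fun v hv => ?_) hw
  rw [hnorm, ← integral_torusLebesgue_mul
    (fun k => (⟨v k, mem_sphere_zero_iff_norm.2 (hv k)⟩ : Circle))
    (fun z : Fin N → Circle => ‖P fun k => (z k : ℂ)‖)]
  refine le_of_eq ?_
  congr 1; funext z
  congr 2; funext k
  exact mul_comm _ _

end

/-! ### Polarization, algebraic and in L¹ -/

/-- The polarization formula. -/
theorem MultilinearMap.polarization {V X : Type*} [AddCommGroup V] [Module ℂ V]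
    [AddCommGroup X] [Module ℂ X] {m : ℕ} (T : MultilinearMap ℂ (fun _ : Fin m => V) X)
    (hT : ∀ (σ : Equiv.Perm (Fin m)) (z : Fin m → V), T (fun j => z (σ j)) = T z)
    (z : Fin m → V) :
    ((2 ^ m * m.factorial : ℕ) : ℂ) • T z =
      ∑ ε : Fin m → ℤˣ, (∏ k, ((ε k : ℤ) : ℂ)) • T (fun _ => ∑ k, ((ε k : ℤ) : ℂ) • z k) := by
  have hexp : ∀ ε : Fin m → ℤˣ,
      (∏ k, ((ε k : ℤ) : ℂ)) • T (fun _ => ∑ k, ((ε k : ℤ) : ℂ) • z k) =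
        ∑ f : Fin m → Fin m,
          ((∏ k, ((ε k : ℤ) : ℂ)) * ∏ j, ((ε (f j) : ℤ) : ℂ)) • T (fun j => z (f j)) := by
    intro ε
    rw [MultilinearMap.map_sum, Finset.smul_sum]
    refine Finset.sum_congr rfl fun f _ => ?_
    rw [MultilinearMap.map_smul_univ, smul_smul]
  -- After expansion by multilinearity, a bijective index map meets each sign twice, so its
  -- coefficient is a sum of 2^m ones.
  have hbij : ∀ f : Fin m → Fin m, f.Bijective →
      (∑ ε : Fin m → ℤˣ, (∏ k, ((ε k : ℤ) : ℂ)) * ∏ j, ((ε (f j) : ℤ) : ℂ)) = 2 ^ m := by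
    intro f hf
    have h1 : ∀ ε : Fin m → ℤˣ, (∏ k, ((ε k : ℤ) : ℂ)) * ∏ j, ((ε (f j) : ℤ) : ℂ) = 1 := by
      intro ε
      rw [hf.prod_comp (fun k => ((ε k : ℤ) : ℂ)), ← Finset.prod_mul_distrib]
      refine Finset.prod_eq_one fun k _ => ?_
      rw [← Int.cast_mul, ← Units.val_mul, Int.units_mul_self]
      simp
    simp [h1]
  -- A non-bijective map misses some k; flipping the k-th sign then changes the sign of every
  -- summand, so the coefficient vanishes.
  have hnot : ∀ f : Fin m → Fin m, ¬ f.Bijective →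
      (∑ ε : Fin m → ℤˣ, (∏ k, ((ε k : ℤ) : ℂ)) * ∏ j, ((ε (f j) : ℤ) : ℂ)) = 0 := by
    intro f hf
    have hs : ¬ f.Surjective := fun h => hf (Finite.surjective_iff_bijective.1 h)
    obtain ⟨k, hk⟩ := not_forall.1 hs
    have hk' : ∀ j, f j ≠ k := fun j hj => hk ⟨j, hj⟩
    have hinv : Function.Involutive (signFlip k) := fun ε => by simp [signFlip]
    have h2 := Equiv.sum_comp hinv.toPerm
      (fun ε : Fin m → ℤˣ => (∏ k, ((ε k : ℤ) : ℂ)) * ∏ j, ((ε (f j) : ℤ) : ℂ))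
    have h3 : ∀ ε : Fin m → ℤˣ,
        (∏ j, ((signFlip k ε j : ℤ) : ℂ)) * ∏ j, ((signFlip k ε (f j) : ℤ) : ℂ) =
          -((∏ k, ((ε k : ℤ) : ℂ)) * ∏ j, ((ε (f j) : ℤ) : ℂ)) := by
      intro ε
      have h4 : ∀ j, signFlip k ε (f j) = ε (f j) := fun j => by simp [signFlip, hk' j]
      have h5 : ∏ j, ((signFlip k ε j : ℤ) : ℂ) = -∏ j, ((ε j : ℤ) : ℂ) := by
        rw [Fintype.prod_eq_mul_prod_compl k, Fintype.prod_eq_mul_prod_compl k, ← neg_mul]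
        congr 1
        · simp [signFlip]
        · refine Finset.prod_congr rfl fun j hj => ?_
          have : j ≠ k := by simpa using hj
          simp [signFlip, this]
      simp only [h4, h5, neg_mul]
    simp only [Function.Involutive.coe_toPerm, h3, Finset.sum_neg_distrib] at h2
    exact self_eq_neg.1 h2.symm
  have hperm : ∑ f : Fin m → Fin m,
      (∑ ε : Fin m → ℤˣ, (∏ k, ((ε k : ℤ) : ℂ)) * ∏ j, ((ε (f j) : ℤ) : ℂ)) •
        T (fun j => z (f j)) = ∑ _σ : Equiv.Perm (Fin m), (2 ^ m : ℂ) • T z := by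
    symm
    refine Finset.sum_of_injOn (fun σ : Equiv.Perm (Fin m) => (σ : Fin m → Fin m))
      (fun σ _ τ _ h => DFunLike.coe_injective h) (fun _ _ => Finset.mem_coe.2 (Finset.mem_univ _))
      (fun f _ hf => ?_) fun σ _ => ?_
    · rw [hnot f fun hb => hf ⟨Equiv.ofBijective f hb, by simp, rfl⟩, zero_smul]
    · rw [hbij _ σ.bijective, hT σ z]
  simp only [hexp]
  rw [Finset.sum_comm]
  simp only [← Finset.sum_smul]
  rw [hperm, Finset.sum_const, Finset.card_univ, Fintype.card_perm, Fintype.card_fin,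
    ← Nat.cast_smul_eq_nsmul ℂ, smul_smul]
  congr 1
  push_cast
  ring

/-- A signed sum of `m` independent points of the torus contributes at most `m^m` times the `L¹`
norm of an `m`-homogeneous polynomial. -/
theorem IsHomogeneousPoly.integral_norm_signSum_le {X : Type*} [NormedAddCommGroup X]
    [NormedSpace ℂ X] {N m : ℕ} {c : (Fin N → ℕ) → X} {P : (Fin N → ℂ) → X}
    (hP : IsHomogeneousPoly N m c P) {T : MultilinearMap ℂ (fun _ : Fin m => Fin N → ℂ) X}
    (hT : ∀ z, T (fun _ => z) = P z) (ε : Fin m → ℤˣ) :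
    ∫ z : Fin m → Fin N → Circle, ‖P (∑ j, ((ε j : ℤ) : ℂ) • fun k => (z j k : ℂ))‖
        ∂(Measure.pi fun _ : Fin m => torusLebesgue N) ≤
      (m : ℝ) ^ m * ∫ z, ‖P (fun k => (z k : ℂ))‖ ∂torusLebesgue N := by
  set ν := Measure.pi fun _ : Fin m => torusLebesgue N
  have hPc := hP.continuous
  -- Dividing by m puts the signed sum into the closed polydisc; homogeneity returns the factor m^m.
  -- For m = 0 the sum is empty, w is zero and 0^0 = 1.
  let w : (Fin m → Fin N → Circle) → Fin N → ℂ := fun z k =>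
    (m : ℂ)⁻¹ * ∑ j, ((ε j : ℤ) : ℂ) * (z j k : ℂ)
  have hw : ∀ z k, ‖w z k‖ ≤ 1 := by
    intro z k
    have h1 : ‖∑ j, ((ε j : ℤ) : ℂ) * (z j k : ℂ)‖ ≤ m := by
      refine (norm_sum_le _ _).trans_eq ?_
      have h2 : ∀ j, ‖((ε j : ℤ) : ℂ) * (z j k : ℂ)‖ = 1 := by
        intro j
        rw [norm_mul, Circle.norm_coe, mul_one]
        rcases Int.units_eq_one_or (ε j) with h | h <;> simp [h]
      rw [Finset.sum_congr rfl fun j _ => h2 j]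
      simp
    rw [norm_mul, norm_inv, Complex.norm_natCast]
    exact inv_mul_le_one_of_le₀ h1 (Nat.cast_nonneg m)
  have hsum : ∀ z : Fin m → Fin N → Circle,
      (∑ j, ((ε j : ℤ) : ℂ) • fun k => (z j k : ℂ)) = (m : ℂ) • w z := by
    intro z
    ext k
    simp only [Finset.sum_apply, Pi.smul_apply, smul_eq_mul, w]
    rcases Nat.eq_zero_or_pos m with rfl | hm
    · simp
    · rw [mul_inv_cancel_left₀ (Nat.cast_ne_zero.2 hm.ne')]
  have hhom : ∀ z : Fin m → Fin N → Circle,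
      ‖P (∑ j, ((ε j : ℤ) : ℂ) • fun k => (z j k : ℂ))‖ = (m : ℝ) ^ m * ‖P (w z)‖ := by
    intro z
    rw [hsum, ← hT, ← hT, MultilinearMap.map_smul_univ T (fun _ => (m : ℂ)) (fun _ => w z)]
    simp [norm_smul]
  simp only [hhom]
  rw [integral_const_mul]
  gcongr
  -- Rotating all m points by a common u rotates w by u. Averaging over u and exchanging integrals
  -- leaves, for fixed z, an integral over the torus of radii |w_k| ≤ 1.
  have hrot : ∀ u : Fin N → Circle,
      ∫ z, ‖P (w z)‖ ∂ν = ∫ z, ‖P (fun k => (u k : ℂ) * w z k)‖ ∂ν := by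
    intro u
    rw [← integral_pi_torusLebesgue_mul (fun _ => u)]
    congr 1; funext z
    congr 2; funext k
    simp only [w, Pi.mul_apply, Circle.coe_mul, Finset.mul_sum]
    refine Finset.sum_congr rfl fun j _ => ?_
    ring
  have hwc : Continuous w := by fun_prop
  have hc : Continuous fun p : (Fin N → Circle) × (Fin m → Fin N → Circle) =>
      ‖P (fun k => (p.1 k : ℂ) * w p.2 k)‖ := by fun_prop
  calc ∫ z, ‖P (w z)‖ ∂ν
      = ∫ _ : Fin N → Circle, ∫ z, ‖P (w z)‖ ∂ν ∂torusLebesgue N := by simp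
    _ = ∫ u : Fin N → Circle, ∫ z, ‖P (fun k => (u k : ℂ) * w z k)‖ ∂ν ∂torusLebesgue N := by
        simp only [← hrot]
    _ = ∫ z, ∫ u : Fin N → Circle, ‖P (fun k => (u k : ℂ) * w z k)‖ ∂torusLebesgue N ∂ν :=
        integral_integral_swap hc.integrable_of_compactSpace
    _ ≤ ∫ _, ∫ u, ‖P (fun k => (u k : ℂ))‖ ∂torusLebesgue N ∂ν := by
        refine integral_mono ?_ (integrable_const _) fun z => hP.integral_norm_mul_le (hw z)
        exact (hc.integrable_of_compactSpace
          (μ := (torusLebesgue N).prod ν)).integral_prod_right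
    _ = ∫ u, ‖P (fun k => (u k : ℂ))‖ ∂torusLebesgue N := by simp

/-- The `L¹` polarization inequality on the torus. -/
theorem IsSymmetrization.integral_norm_le {X : Type*} [NormedAddCommGroup X] [NormedSpace ℂ X]
    {N m : ℕ} {c : (Fin N → ℕ) → X} {P : (Fin N → ℂ) → X} (hP : IsHomogeneousPoly N m c P)
    {T : MultilinearMap ℂ (fun _ : Fin m => Fin N → ℂ) X} (hT : IsSymmetrization T P) :
    ∫ z : Fin m → Fin N → Circle, ‖T (fun j k => (z j k : ℂ))‖
        ∂(Measure.pi fun _ : Fin m => torusLebesgue N) ≤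
      (m : ℝ) ^ m / (m.factorial : ℝ) *
        ∫ z, ‖P (fun k => (z k : ℂ))‖ ∂torusLebesgue N := by
  set ν := Measure.pi fun _ : Fin m => torusLebesgue N
  have hPc := hP.continuous
  have hfac : (0 : ℝ) < 2 ^ m * m.factorial := by positivity
  have hpol : ∀ z : Fin m → Fin N → ℂ, ‖T z‖ ≤
      (2 ^ m * m.factorial : ℝ)⁻¹ * ∑ ε : Fin m → ℤˣ, ‖P (∑ j, ((ε j : ℤ) : ℂ) • z j)‖ := by
    intro z
    have h := congrArg norm (T.polarization hT.1 z)
    rw [norm_smul, Complex.norm_natCast] at h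
    push_cast at h
    rw [le_inv_mul_iff₀ hfac, h]
    refine (norm_sum_le _ _).trans_eq (Finset.sum_congr rfl fun ε _ => ?_)
    have h1 : ‖∏ k, ((ε k : ℤ) : ℂ)‖ = 1 := by
      rw [norm_prod]
      refine Finset.prod_eq_one fun k _ => ?_
      rcases Int.units_eq_one_or (ε k) with h | h <;> simp [h]
    rw [norm_smul, h1, one_mul, hT.2]
  have hint : ∀ ε : Fin m → ℤˣ, Integrable (fun z : Fin m → Fin N → Circle =>
      ‖P (∑ j, ((ε j : ℤ) : ℂ) • fun k => (z j k : ℂ))‖) ν := fun ε =>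
    Continuous.integrable_of_compactSpace (by fun_prop)
  calc ∫ z : Fin m → Fin N → Circle, ‖T (fun j k => (z j k : ℂ))‖ ∂ν
      ≤ ∫ z : Fin m → Fin N → Circle, (2 ^ m * m.factorial : ℝ)⁻¹ *
          ∑ ε : Fin m → ℤˣ, ‖P (∑ j, ((ε j : ℤ) : ℂ) • fun k => (z j k : ℂ))‖ ∂ν :=
        integral_mono_of_nonneg (Filter.Eventually.of_forall fun _ => norm_nonneg _)
          ((integrable_finsetSum _ fun ε _ => hint ε).const_mul _)
          (Filter.Eventually.of_forall fun z => hpol _)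
    -- Each of the 2^m sign patterns contributes at most m^m ∫‖P‖, so the powers of 2 cancel and
    -- m^m/m! remains.
    _ ≤ (2 ^ m * m.factorial : ℝ)⁻¹ * ∑ _ε : Fin m → ℤˣ,
          (m : ℝ) ^ m * ∫ z, ‖P (fun k => (z k : ℂ))‖ ∂torusLebesgue N := by
        rw [integral_const_mul, integral_finsetSum _ fun ε _ => hint ε]
        gcongr with ε
        exact hP.integral_norm_signSum_le hT.2 ε
    _ = _ := by
        simp only [Finset.sum_const, Finset.card_univ, Fintype.card_pi, Fintype.card_units_int,
          Finset.prod_const, Fintype.card_fin, nsmul_eq_mul]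
        push_cast
        field_simp

end

/-! ### Conclusion -/

theorem mainTheorem3 {X : Type u} [NormedAddCommGroup X] [NormedSpace ℂ X] [CompleteSpace X]
    (q : ℝ) (hq : 2 ≤ q) (hX : HasCotype X q)
    (N m : ℕ) (c : (Fin N → ℕ) → X) (P : (Fin N → ℂ) → X) (hP : IsHomogeneousPoly N m c P)
    (T : MultilinearMap ℂ (fun _ : Fin m => Fin N → ℂ) X) (hT : IsSymmetrization T P)
    (a : (Fin m → Fin N) → X)
    (ha : ∀ z : Fin m → Fin N → ℂ, T z = ∑ i : Fin m → Fin N, (∏ j, z j (i j)) • a i) :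
    (∑ i : Fin m → Fin N, ‖a i‖ ^ q) ^ (1 / q) ≤
      (cotypeConst X q * kahaneConst.{u}) ^ m * ((m : ℝ) ^ m / (m.factorial : ℝ)) *
        ∫ z, ‖P (fun k => (z k : ℂ))‖ ∂torusLebesgue N := by
  obtain ⟨hC0, hC⟩ := hX.isCotypeConstant_cotypeConst
  obtain ⟨hK1, hK⟩ := isKahaneConstant_kahaneConst.{u}
  have hD : 0 ≤ cotypeConst X q * kahaneConst.{u} := mul_nonneg hC0 (by linarith)
  have h := rpow_sum_norm_coeff_le (by linarith) hD (N := N) (fun x => (hC N x).trans (by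
    rw [mul_assoc]
    exact mul_le_mul_of_nonneg_left (hK X N x) hC0)) m a
  have hform : ∀ z : Fin m → Fin N → Circle,
      ∑ i, (∏ j, (z j (i j) : ℂ)) • a i = T (fun j k => (z j k : ℂ)) := fun z =>
    (ha fun j k => (z j k : ℂ)).symm
  simp only [hform] at h
  refine h.trans ?_
  rw [mul_assoc]
  exact mul_le_mul_of_nonneg_left (IsSymmetrization.integral_norm_le hP hT) (pow_nonneg hD m)
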